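/- Let $F_n$ and $L_n$ be the Fibonacci and Lucas numbers ($F_0=0$, $F_1=1$; $L_0=2$, $L_1=1$; both satisfying $X_n=X_{n-1}+X_{n-2}$ for $n\ge 2$), and let $\alpha=(1+\sqrt5)/2$ be the golden ratio. If $r$ is a non-negative integer, then $$\sum_{k=1}^\infty \frac{(-1)^{k(r-1)}\left(\frac{27}{5}\right)^k}{k^2\binom{3k}{k}F_{3r}^{2k}} = 6\arctan^2\!\left(\frac{\sqrt3}{\alpha^{2r}+\alpha^r L_r}\right)-\frac12\log^2\!\left(\frac{F_{3r}}{5F_r^3}\right),\qquad r\neq 0,$$ $$\sum_{k=1}^\infty \frac{(-1)^{kr}\,27^k}{k^2\binom{3k}{k}L_{3r}^{2k}} = 6\arctan^2\!\left(\frac{\sqrt3}{\alpha^{2r}+\sqrt5\,\alpha^r F_r}\right)-\frac12\log^2\!\left(\frac{L_{3r}}{L_r^3}\right),$$ where both series converge (the first for $r\ge 1$, the second for all $r\ge 0$). -/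

import Mathlib

/-- The Lucas numbers `L₀ = 2`, `L₁ = 1`, `Lₙ₊₂ = Lₙ₊₁ + Lₙ`. -/
def lucasNumber : ℕ → ℕ
  | 0 => 2
  | 1 => 1
  | n + 2 => lucasNumber (n + 1) + lucasNumber n

/-! Put S(z) = ∑ zᵏ / (k² C(3k,k)). The Beta integral 1/(k C(3k,k)) = ∫₀¹ w²ᵏ(1-w)ᵏ⁻¹ dw and a
geometric series give S'(z) = ∫₀¹ w²/(1 - z w²(1-w)) dw for |z| < 27/4. With z = 27t³/(1+t³)² the
cubic denominator splits into a linear and a quadratic factor rational in t, so the integral is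
elementary (`integral_sq_div_one_sub`). Its product with dz/dt is the derivative of 6
arctan²(√3t/(2-t)) - ½ log²((1-t+t²)/(1+t)²), and both functions vanish at t = 0
(`chooseSeries_eq_closedForm`); t = 1 follows by a limit.

With x = αʳ, y = βʳ for the conjugate β of α, xy = (-1)ʳ, the choices t = -y/x and t = y/x give the
Fibonacci and Lucas sums. In the Lucas case r = 0 is exactly the endpoint t = 1, z = 27/4. -/

/-! ### Beta integrals for inverse binomial coefficients -/

theorem integral_pow_mul_one_sub_pow (m n : ℕ) :
    ∫ w in (0 : ℝ)..1, w ^ m * (1 - w) ^ n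
      = (m.factorial : ℝ) * n.factorial / (m + n + 1).factorial := by
  have h := Complex.Gamma_mul_Gamma_eq_betaIntegral (s := (m : ℂ) + 1) (t := (n : ℂ) + 1)
    (by simp; positivity) (by simp; positivity)
  rw [Complex.Gamma_nat_eq_factorial, Complex.Gamma_nat_eq_factorial,
    show (m : ℂ) + 1 + (n + 1) = ((m + n + 1 : ℕ) : ℂ) + 1 by push_cast; ring,
    Complex.Gamma_nat_eq_factorial, Complex.betaIntegral] at h
  have e : ∫ x in (0 : ℝ)..1, (x : ℂ) ^ ((m : ℂ) + 1 - 1) * (1 - (x : ℂ)) ^ ((n : ℂ) + 1 - 1)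
      = ((∫ w in (0 : ℝ)..1, w ^ m * (1 - w) ^ n : ℝ) : ℂ) := by
    rw [← intervalIntegral.integral_ofReal]
    refine intervalIntegral.integral_congr fun x _ => ?_
    simp
  rw [e] at h
  have hne : ((m + n + 1).factorial : ℝ) ≠ 0 := by positivity
  rw [eq_div_iff hne, mul_comm]
  exact_mod_cast h.symm

/-- The reciprocals of `k * (3k choose k)`, with `k = n + 1`. -/
noncomputable def invMulChoose (n : ℕ) : ℝ :=
  1 / (((n + 1 : ℕ) : ℝ) * (Nat.choose (3 * (n + 1)) (n + 1) : ℝ))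

theorem invMulChoose_eq_integral (n : ℕ) :
    invMulChoose n = ∫ w in (0 : ℝ)..1, w ^ (2 * n + 2) * (1 - w) ^ n := by
  rw [integral_pow_mul_one_sub_pow, invMulChoose,
    Nat.cast_choose ℝ (show n + 1 ≤ 3 * (n + 1) by omega),
    show 3 * (n + 1) - (n + 1) = 2 * n + 2 by omega,
    show 2 * n + 2 + n + 1 = 3 * (n + 1) by ring, Nat.factorial_succ n]
  have h1 : ((3 * (n + 1)).factorial : ℝ) ≠ 0 := by positivity
  have h2 : ((2 * n + 2).factorial : ℝ) ≠ 0 := by positivity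
  have h3 : (n.factorial : ℝ) ≠ 0 := by positivity
  push_cast
  field_simp

theorem sq_mul_one_sub_le {w : ℝ} (h0 : 0 ≤ w) : w ^ 2 * (1 - w) ≤ 4 / 27 := by
  -- The maximum is at w = 2/3: 4/27 - w²(1-w) = (w - 2/3)²(w + 1/3).
  nlinarith [mul_nonneg (sq_nonneg (w - 2 / 3)) (by linarith : 0 ≤ w + 1 / 3)]

theorem pow_mul_pow_le {w : ℝ} (h0 : 0 ≤ w) (h1 : w ≤ 1) (n : ℕ) :
    w ^ (2 * n + 2) * (1 - w) ^ n ≤ (4 / 27) ^ n := by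
  have h2 : 0 ≤ w ^ 2 * (1 - w) := mul_nonneg (by positivity) (by linarith)
  calc w ^ (2 * n + 2) * (1 - w) ^ n = (w ^ 2 * (1 - w)) ^ n * w ^ 2 := by
        rw [mul_pow, ← pow_mul]; ring
    _ ≤ (4 / 27) ^ n * 1 := by
        gcongr
        · exact sq_mul_one_sub_le h0
        · exact pow_le_one₀ h0 h1
    _ = _ := mul_one _

theorem invMulChoose_pos (n : ℕ) : 0 < invMulChoose n := by
  have : 0 < Nat.choose (3 * (n + 1)) (n + 1) := Nat.choose_pos (by omega)
  unfold invMulChoose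
  positivity

theorem invMulChoose_le (n : ℕ) : invMulChoose n ≤ (4 / 27) ^ n := by
  rw [invMulChoose_eq_integral]
  calc _ ≤ ∫ w in (0 : ℝ)..1, (4 / 27 : ℝ) ^ n := by
        refine intervalIntegral.integral_mono_on (by norm_num) ?_ ?_ fun w hw =>
          pow_mul_pow_le hw.1 hw.2 n
        · exact Continuous.intervalIntegrable (by fun_prop) _ _
        · exact Continuous.intervalIntegrable (by fun_prop) _ _
    _ = _ := by simp

theorem abs_mul_four_div_lt_one {z : ℝ} (hz : |z| < 27 / 4) : |z| * (4 / 27) < 1 := by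
  linarith

theorem summable_geometric_bound {ρ : ℝ} (h0 : 0 ≤ ρ) (hρ : ρ < 27 / 4) :
    Summable fun n : ℕ => (ρ * (4 / 27)) ^ n :=
  summable_geometric_of_lt_one (by positivity) (by linarith)

/-! ### The power series and its derivative -/

theorem hasSum_invMulChoose_mul_pow {z : ℝ} (hz : |z| < 27 / 4) :
    HasSum (fun n => invMulChoose n * z ^ n)
      (∫ w in (0 : ℝ)..1, w ^ 2 / (1 - z * (w ^ 2 * (1 - w)))) := by
  have key : HasSum (fun n : ℕ => ∫ w in (0 : ℝ)..1, z ^ n * (w ^ (2 * n + 2) * (1 - w) ^ n))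
      (∫ w in (0 : ℝ)..1, w ^ 2 / (1 - z * (w ^ 2 * (1 - w)))) := by
    refine intervalIntegral.hasSum_integral_of_dominated_convergence
      (fun n _ => (|z| * (4 / 27)) ^ n) ?_ ?_ ?_ ?_ ?_
    · intro n
      exact Continuous.aestronglyMeasurable (by fun_prop)
    · intro n
      refine Filter.Eventually.of_forall fun w hw => ?_
      rw [Set.uIoc_of_le zero_le_one] at hw
      have h2 : 0 ≤ w ^ (2 * n + 2) * (1 - w) ^ n :=
        mul_nonneg (pow_nonneg hw.1.le _) (pow_nonneg (by linarith [hw.2]) _)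
      rw [norm_mul, norm_pow, Real.norm_eq_abs, Real.norm_of_nonneg h2, mul_pow]
      gcongr
      exact pow_mul_pow_le hw.1.le hw.2 n
    · exact Filter.Eventually.of_forall fun w _ => summable_geometric_bound (abs_nonneg z) hz
    · exact intervalIntegrable_const
    · refine Filter.Eventually.of_forall fun w hw => ?_
      rw [Set.uIoc_of_le zero_le_one] at hw
      have h2 : 0 ≤ w ^ 2 * (1 - w) := mul_nonneg (by positivity) (by linarith [hw.2])
      have h3 : ‖z * (w ^ 2 * (1 - w))‖ < 1 := by
        rw [norm_mul, Real.norm_eq_abs, Real.norm_of_nonneg h2]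
        exact (mul_le_mul_of_nonneg_left (sq_mul_one_sub_le hw.1.le) (abs_nonneg z)).trans_lt
          (abs_mul_four_div_lt_one hz)
      have h4 := (hasSum_geometric_of_norm_lt_one h3).mul_left (w ^ 2)
      rw [div_eq_mul_inv]
      refine h4.congr_fun ?_ 
      intro n
      simp only [mul_pow, ← pow_mul]
      ring
  refine key.congr_fun fun n => ?_
  rw [intervalIntegral.integral_const_mul, invMulChoose_eq_integral, mul_comm]

/-- The series `∑ zᵏ / (k² (3k choose k))` over `k ≥ 1`. -/
noncomputable def chooseSeries (z : ℝ) : ℝ :=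
  ∑' n : ℕ, z ^ (n + 1) * invMulChoose n / ((n + 1 : ℕ) : ℝ)

theorem norm_chooseSeries_term_le {z ρ : ℝ} (hz : |z| ≤ ρ) (n : ℕ) :
    ‖z ^ (n + 1) * invMulChoose n / ((n + 1 : ℕ) : ℝ)‖
      ≤ ρ ^ (n + 1) * invMulChoose n / ((n + 1 : ℕ) : ℝ) := by
  rw [norm_div, norm_mul, norm_pow, Real.norm_eq_abs, Real.norm_of_nonneg (invMulChoose_pos n).le,
    Real.norm_of_nonneg (Nat.cast_nonneg _)]
  have := (invMulChoose_pos n).le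
  gcongr

theorem summable_chooseSeries {z : ℝ} (hz : |z| < 27 / 4) :
    Summable fun n : ℕ => z ^ (n + 1) * invMulChoose n / ((n + 1 : ℕ) : ℝ) := by
  refine Summable.of_norm_bounded (g := fun n => |z| * (|z| * (4 / 27)) ^ n)
    ((summable_geometric_bound (abs_nonneg z) hz).mul_left _) fun n => ?_
  refine (norm_chooseSeries_term_le le_rfl n).trans ?_
  have h := invMulChoose_le n
  have h0 := (invMulChoose_pos n).le
  calc _ ≤ |z| ^ (n + 1) * invMulChoose n := div_le_self (by positivity) (by simp)
    _ ≤ |z| ^ (n + 1) * (4 / 27) ^ n := by gcongr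
    _ = _ := by rw [mul_pow]; ring

theorem hasDerivAt_chooseSeries {z : ℝ} (hz : |z| < 27 / 4) :
    HasDerivAt chooseSeries (∫ w in (0 : ℝ)..1, w ^ 2 / (1 - z * (w ^ 2 * (1 - w)))) z := by
  -- On the ball of radius ρ the differentiated series has one geometric majorant.
  obtain ⟨ρ, h1, h2⟩ := exists_between hz
  rw [← (hasSum_invMulChoose_mul_pow hz).tsum_eq]
  refine hasDerivAt_tsum_of_isPreconnected (t := Metric.ball 0 ρ) (y₀ := z)
    (u := fun n => (ρ * (4 / 27)) ^ n) (g' := fun n y => invMulChoose n * y ^ n)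
    (summable_geometric_bound ((abs_nonneg z).trans h1.le) h2) Metric.isOpen_ball
    (convex_ball _ _).isPreconnected ?_ ?_ (by simpa using h1) (summable_chooseSeries hz)
    (by simpa using h1)
  · intro n y _
    have h := ((hasDerivAt_pow (n + 1) y).mul_const (invMulChoose n)).div_const ((n + 1 : ℕ) : ℝ)
    refine h.congr_deriv ?_
    have : ((n + 1 : ℕ) : ℝ) ≠ 0 := by positivity
    field_simp
    simp [mul_comm]
  · intro n y hy
    have hy' : |y| < ρ := by simpa using hy
    rw [norm_mul, norm_pow, Real.norm_eq_abs, Real.norm_eq_abs, abs_of_pos (invMulChoose_pos n),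
      mul_pow, mul_comm]
    have := invMulChoose_le n
    have := (abs_nonneg y).trans hy'.le
    have := (invMulChoose_pos n).le
    gcongr

/-! ### Elementary evaluation of the integral -/

open Real Filter Topology

theorem hasDerivAt_arctan_sqrt_three_mul_div {t : ℝ} (h1 : t < 2) :
    HasDerivAt (fun t => arctan (√3 * t / (2 - t))) (√3 / 2 / (1 - t + t ^ 2)) t := by
  have hs : √3 ^ 2 = 3 := Real.sq_sqrt (by norm_num)
  have hp : 0 < 1 - t + t ^ 2 := by nlinarith [sq_nonneg (t - 1 / 2)]
  have h2 : (2 - t) ≠ 0 := by linarith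
  have h := (((hasDerivAt_id t).const_mul √3).div ((hasDerivAt_id t).const_sub 2) h2).arctan
  refine h.congr_deriv ?_
  have e : 1 + (√3 * t / (2 - t)) ^ 2 = 4 * (1 - t + t ^ 2) / (2 - t) ^ 2 := by
    rw [div_pow, mul_pow, hs]; field_simp; ring
  simp only [id, Pi.div_apply] at *
  rw [e]
  field_simp
  ring

/-- Both sides vanish at t = 0 and have the same derivative on (-1, 1), which avoids tracking
branches in the addition formula. The left side is the arctangent increment over [0, 1] in
`integral_sq_div_one_sub`. -/
theorem arctan_sub_arctan_eq_three_mul_arctan {t : ℝ} (h0 : -1 < t) (h1 : t < 1) :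
    arctan ((6 * t - (1 + t) ^ 2) / (√3 * (1 - t ^ 2)))
      - arctan (-(1 + t) ^ 2 / (√3 * (1 - t ^ 2))) = 3 * arctan (√3 * t / (2 - t)) := by
  have hs : √3 ^ 2 = 3 := Real.sq_sqrt (by norm_num)
  have hs0 : √3 ≠ 0 := by positivity
  have hd1 : ∀ x ∈ Set.Ioo (-1 : ℝ) 1, HasDerivAt
      (fun t : ℝ => arctan ((6 * t - (1 + t) ^ 2) / (√3 * (1 - t ^ 2)))
        - arctan (-(1 + t) ^ 2 / (√3 * (1 - t ^ 2))))
      (3 * (√3 / 2 / (1 - x + x ^ 2))) x := by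
    intro x hx
    have hp : 0 < 1 - x + x ^ 2 := by nlinarith [sq_nonneg (x - 1 / 2)]
    have ha : 1 - x ≠ 0 := by linarith [hx.2]
    have hb : 1 + x ≠ 0 := by linarith [hx.1]
    have hc : 1 - x ^ 2 ≠ 0 := by
      rw [show 1 - x ^ 2 = (1 - x) * (1 + x) by ring]; exact mul_ne_zero ha hb
    have hd : √3 * (1 - x ^ 2) ≠ 0 := mul_ne_zero hs0 hc
    have n1 : HasDerivAt (fun t : ℝ => (1 + t) ^ 2) (2 * (1 + x)) x := by
      have := ((hasDerivAt_id x).const_add 1).pow 2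
      refine this.congr_deriv ?_
      simp
    have d1 : HasDerivAt (fun t : ℝ => √3 * (1 - t ^ 2)) (√3 * (-(2 * x))) x := by
      have := ((hasDerivAt_pow 2 x).const_sub 1).const_mul √3
      refine this.congr_deriv ?_
      simp
    have n2 : HasDerivAt (fun t : ℝ => 6 * t - (1 + t) ^ 2) (6 - 2 * (1 + x)) x := by
      have := ((hasDerivAt_id x).const_mul 6).sub n1
      refine this.congr_deriv ?_
      simp
    have h := (n2.fun_div d1 hd).arctan.sub (n1.neg.fun_div d1 hd).arctan
    refine h.congr_deriv ?_
    have e1 : 1 + ((6 * x - (1 + x) ^ 2) / (√3 * (1 - x ^ 2))) ^ 2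
        = 4 * (1 - x + x ^ 2) ^ 2 / (3 * (1 - x ^ 2) ^ 2) := by
      rw [div_pow, mul_pow, hs]; field_simp; ring
    have e2 : 1 + (-(1 + x) ^ 2 / (√3 * (1 - x ^ 2))) ^ 2
        = 4 * (1 + x) ^ 2 * (1 - x + x ^ 2) / (3 * (1 - x ^ 2) ^ 2) := by
      rw [div_pow, mul_pow, hs]; field_simp; ring
    simp only [Pi.neg_apply]
    rw [e1, e2, mul_pow, hs]
    field_simp
    ring
  have hd2 : ∀ x ∈ Set.Ioo (-1 : ℝ) 1, HasDerivAt
      (fun t : ℝ => 3 * arctan (√3 * t / (2 - t))) (3 * (√3 / 2 / (1 - x + x ^ 2))) x :=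
    fun x hx => (hasDerivAt_arctan_sqrt_three_mul_div (by linarith [hx.2])).const_mul 3
  refine IsOpen.eqOn_of_deriv_eq isOpen_Ioo isPreconnected_Ioo
    (fun x hx => (hd1 x hx).differentiableAt.differentiableWithinAt)
    (fun x hx => (hd2 x hx).differentiableAt.differentiableWithinAt)
    (fun x hx => by rw [(hd1 x hx).deriv, (hd2 x hx).deriv])
    (show (0 : ℝ) ∈ Set.Ioo (-1 : ℝ) 1 by norm_num) (by norm_num) ⟨h0, h1⟩

/-- The denominator is L·Q, where L has the root w = -(1-t+t²)/(3t) and Q has no real root; partial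
fractions then give the antiderivative F. -/
theorem integral_sq_div_one_sub {t : ℝ} (h0 : -1 < t) (h1 : t < 1) (ht : t ≠ 0) :
    ∫ w in (0 : ℝ)..1, w ^ 2 / (1 - 27 * t ^ 3 / (1 + t ^ 3) ^ 2 * (w ^ 2 * (1 - w)))
      = (1 + t ^ 3) ^ 2 / (81 * t ^ 2 * (1 - t ^ 3)) *
        (6 * √3 * (1 + t) * arctan (√3 * t / (2 - t))
          + 3 * (1 - t) * log ((1 - t + t ^ 2) / (1 + t) ^ 2)) := by
  have hs : √3 ^ 2 = 3 := Real.sq_sqrt (by norm_num)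
  have hs0 : √3 ≠ 0 := by positivity
  have hp : 0 < 1 - t + t ^ 2 := by nlinarith [sq_nonneg (t - 1 / 2)]
  have hq : 0 < 1 + t + t ^ 2 := by nlinarith [sq_nonneg (t + 1 / 2)]
  have ha : 0 < 1 - t := by linarith
  have hb : 0 < 1 + t := by linarith
  have hc : 1 - t ^ 2 = (1 - t) * (1 + t) := by ring
  have hz : 1 + t ^ 3 = (1 + t) * (1 - t + t ^ 2) := by ring
  have hz' : 1 - t ^ 3 = (1 - t) * (1 + t + t ^ 2) := by ring
  set L : ℝ → ℝ := fun w => 1 + 3 * t / (1 - t + t ^ 2) * w with hL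
  set Q : ℝ → ℝ := fun w => 1 - 3 * t / (1 - t + t ^ 2) * w
    + 9 * t ^ 2 / ((1 + t) ^ 2 * (1 - t + t ^ 2)) * w ^ 2 with hQ
  set v : ℝ → ℝ := fun w => (6 * t * w - (1 + t) ^ 2) / (√3 * (1 - t ^ 2)) with hv
  have hLpos : ∀ w ∈ Set.Icc (0 : ℝ) 1, 0 < L w := by
    intro w hw
    -- The numerator is a convex combination of two positive numbers, so negative t needs no
    -- separate case.
    have : L w = ((1 - w) * (1 - t + t ^ 2) + w * (1 + t) ^ 2) / (1 - t + t ^ 2) := by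
      simp only [hL]; field_simp; ring
    rw [this]
    refine div_pos ?_ hp
    have h2 := mul_nonneg (sub_nonneg.2 hw.2) hp.le
    have h3 := mul_nonneg hw.1 (sq_nonneg (1 + t))
    rcases hw.1.eq_or_lt with h | h
    · rw [← h]; simpa using hp
    · have := mul_pos h (pow_pos hb 2)
      linarith
  -- Completing the square in Q; v is the resulting arctangent variable.
  have hQv : ∀ w, Q w = 3 * (1 - t) ^ 2 * (1 + v w ^ 2) / (4 * (1 - t + t ^ 2)) := by
    intro w
    simp only [hQ, hv]
    rw [div_pow, mul_pow, hs, hc]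
    field_simp
    ring
  have hQpos : ∀ w, 0 < Q w := by
    intro w
    rw [hQv]
    positivity
  have hLQ : ∀ w, 1 - 27 * t ^ 3 / (1 + t ^ 3) ^ 2 * (w ^ 2 * (1 - w)) = L w * Q w := by
    intro w
    simp only [hL, hQ]
    rw [hz]
    field_simp
    ring
  set K : ℝ := (1 + t ^ 3) ^ 2 / (81 * t ^ 3 * (1 + t + t ^ 2)) with hK
  set F : ℝ → ℝ := fun w => K * ((1 - t + t ^ 2) * log (L w) + (1 + t) ^ 2 * log (Q w)
    + 2 * √3 * t * (1 + t) / (1 - t) * arctan (v w)) with hF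
  have hderiv : ∀ w ∈ Set.uIcc (0 : ℝ) 1, HasDerivAt F
      (w ^ 2 / (1 - 27 * t ^ 3 / (1 + t ^ 3) ^ 2 * (w ^ 2 * (1 - w)))) w := by
    intro w hw
    rw [Set.uIcc_of_le zero_le_one] at hw
    have dL : HasDerivAt L (3 * t / (1 - t + t ^ 2)) w := by
      have := ((hasDerivAt_id w).const_mul (3 * t / (1 - t + t ^ 2))).const_add 1
      exact this.congr_deriv (by simp)
    have dQ : HasDerivAt Q (-(3 * t / (1 - t + t ^ 2))
        + 9 * t ^ 2 / ((1 + t) ^ 2 * (1 - t + t ^ 2)) * (2 * w)) w := by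
      have := (((hasDerivAt_id w).const_mul (3 * t / (1 - t + t ^ 2))).const_sub 1).add
        ((hasDerivAt_pow 2 w).const_mul (9 * t ^ 2 / ((1 + t) ^ 2 * (1 - t + t ^ 2))))
      exact this.congr_deriv (by simp)
    have dv : HasDerivAt v (6 * t / (√3 * (1 - t ^ 2))) w := by
      have := (((hasDerivAt_id w).const_mul (6 * t)).sub_const ((1 + t) ^ 2)).div_const
        (√3 * (1 - t ^ 2))
      exact this.congr_deriv (by simp)
    have h := ((((dL.log (hLpos w hw).ne').const_mul (1 - t + t ^ 2)).add
      ((dQ.log (hQpos w).ne').const_mul ((1 + t) ^ 2))).add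
      (dv.arctan.const_mul (2 * √3 * t * (1 + t) / (1 - t)))).const_mul K
    refine h.congr_deriv ?_
    have e : 1 / (1 + v w ^ 2) = 3 * (1 - t) ^ 2 / (4 * (1 - t + t ^ 2)) / Q w := by
      rw [hQv w]; field_simp
    have e2 : 2 * √3 * t * (1 + t) / (1 - t) * (1 / (1 + v w ^ 2) * (6 * t / (√3 * (1 - t ^ 2))))
        = 9 * t ^ 2 / (1 - t + t ^ 2) / Q w := by
      rw [e, hc]; field_simp; ring
    rw [e2, hLQ]
    have hl := (hLpos w hw).ne'
    have hqq := (hQpos w).ne'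
    have e3 : ∀ a b c : ℝ, (1 - t + t ^ 2) * (a / L w) + (1 + t) ^ 2 * (b / Q w) + c / Q w
        = ((1 - t + t ^ 2) * a * Q w + ((1 + t) ^ 2 * b + c) * L w) / (L w * Q w) := by
      intro a b c; field_simp; ring
    rw [e3, ← mul_div_assoc]
    congr 1
    simp only [hL, hQ, hK]
    rw [hz]
    field_simp
    ring
  have hint : IntervalIntegrable
      (fun w : ℝ => w ^ 2 / (1 - 27 * t ^ 3 / (1 + t ^ 3) ^ 2 * (w ^ 2 * (1 - w))))
      MeasureTheory.volume 0 1 := by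
    refine ContinuousOn.intervalIntegrable ?_
    refine ContinuousOn.div (by fun_prop) (by fun_prop) fun w hw => ?_
    rw [Set.uIcc_of_le zero_le_one] at hw
    rw [hLQ]
    exact (mul_pos (hLpos w hw) (hQpos w)).ne'
  rw [intervalIntegral.integral_eq_sub_of_hasDerivAt hderiv hint]
  -- Since w²(1-w) vanishes at w = 1, L and Q are reciprocal there, and the two logarithms merge
  -- into one.
  have hL1 : L 1 = ((1 - t + t ^ 2) / (1 + t) ^ 2)⁻¹ := by
    simp only [hL]; field_simp; ring
  have hQ1 : Q 1 = (1 - t + t ^ 2) / (1 + t) ^ 2 := by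
    simp only [hQ]; field_simp; ring
  have hL0 : L 0 = 1 := by simp [hL]
  have hQ0 : Q 0 = 1 := by simp [hQ]
  have hv01 : arctan (v 1) = arctan (v 0) + 3 * arctan (√3 * t / (2 - t)) := by
    rw [← arctan_sub_arctan_eq_three_mul_arctan h0 h1]
    simp [hv]
  simp only [hF]
  rw [hL1, hQ1, hL0, hQ0, hv01, log_inv, log_one, hK, hz', hz]
  field_simp
  ring

/-! ### The closed form inside the disc of convergence -/

/-- The closed form of `chooseSeries` in terms of the uniformizing parameter `t`. -/
noncomputable def chooseSeriesClosedForm (t : ℝ) : ℝ :=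
  6 * arctan (√3 * t / (2 - t)) ^ 2 - 1 / 2 * log ((1 - t + t ^ 2) / (1 + t) ^ 2) ^ 2

/-- With u = t³ the upper bound is (1-u)² > 0 and the lower one is u² + 6u + 1 > 0, true for u > -3
+ 2√2. The cutoff t > -1/2 is a convenient sufficient condition, not the sharp one. -/
theorem abs_cubic_parameter_lt {t : ℝ} (h0 : -1 / 2 < t) (h1 : t < 1) :
    |27 * t ^ 3 / (1 + t ^ 3) ^ 2| < 27 / 4 := by
  have hu : -1 / 8 < t ^ 3 := by
    have := Odd.strictMono_pow (R := ℝ) (n := 3) (by decide) h0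
    norm_num at this ⊢
    exact this
  have hu1 : t ^ 3 < 1 := by
    have := Odd.strictMono_pow (R := ℝ) (n := 3) (by decide) h1
    simpa using this
  have hpos : 0 < (1 + t ^ 3) ^ 2 := by
    have : 0 < 1 + t ^ 3 := by linarith
    positivity
  rw [abs_lt, lt_div_iff₀ hpos, div_lt_iff₀ hpos]
  constructor
  · nlinarith [sq_nonneg (t ^ 3)]
  · nlinarith [pow_pos (sub_pos.2 hu1) 2]

theorem hasDerivAt_chooseSeriesClosedForm {t : ℝ} (h0 : -1 < t) (h1 : t < 1) :
    HasDerivAt chooseSeriesClosedForm ((6 * √3 * (1 + t) * arctan (√3 * t / (2 - t))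
      + 3 * (1 - t) * log ((1 - t + t ^ 2) / (1 + t) ^ 2)) / (1 + t ^ 3)) t := by
  have hp : 0 < 1 - t + t ^ 2 := by nlinarith [sq_nonneg (t - 1 / 2)]
  have hb : 0 < 1 + t := by linarith
  have hz : 1 + t ^ 3 = (1 + t) * (1 - t + t ^ 2) := by ring
  have d1 : HasDerivAt (fun t : ℝ => (1 + t) ^ 2) (2 * (1 + t)) t := by
    have := ((hasDerivAt_id t).const_add 1).pow 2
    exact this.congr_deriv (by simp)
  have d2 : HasDerivAt (fun t : ℝ => 1 - t + t ^ 2) (-1 + 2 * t) t := by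
    have := ((hasDerivAt_id t).const_sub 1).add (hasDerivAt_pow 2 t)
    exact this.congr_deriv (by simp)
  have h := (((hasDerivAt_arctan_sqrt_three_mul_div (by linarith : t < 2)).pow 2).const_mul 6).sub
    ((((d2.fun_div d1 (by positivity)).log (by positivity)).pow 2).const_mul (1 / 2))
  refine h.congr_deriv ?_
  rw [hz]
  field_simp
  ring

/-- Chain rule: dz/dt = 81t²(1-t³)/(1+t³)³ cancels the prefactor of the integral, leaving 1/(1+t³).
-/
theorem hasDerivAt_chooseSeries_comp {t : ℝ} (h0 : -1 / 2 < t) (h1 : t < 1) :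
    HasDerivAt (fun t => chooseSeries (27 * t ^ 3 / (1 + t ^ 3) ^ 2))
      ((6 * √3 * (1 + t) * arctan (√3 * t / (2 - t))
        + 3 * (1 - t) * log ((1 - t + t ^ 2) / (1 + t) ^ 2)) / (1 + t ^ 3)) t := by
  have hb : 0 < 1 + t := by linarith
  have ha : 0 < 1 - t := by linarith
  have hp : 0 < 1 - t + t ^ 2 := by nlinarith [sq_nonneg (t - 1 / 2)]
  have hq : 0 < 1 + t + t ^ 2 := by nlinarith [sq_nonneg (t + 1 / 2)]
  have hz : 0 < 1 + t ^ 3 := by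
    rw [show 1 + t ^ 3 = (1 + t) * (1 - t + t ^ 2) by ring]; positivity
  have hz' : 0 < 1 - t ^ 3 := by
    rw [show 1 - t ^ 3 = (1 - t) * (1 + t + t ^ 2) by ring]; positivity
  have dz : HasDerivAt (fun t : ℝ => 27 * t ^ 3 / (1 + t ^ 3) ^ 2)
      (81 * t ^ 2 * (1 - t ^ 3) / (1 + t ^ 3) ^ 3) t := by
    have h := ((hasDerivAt_pow 3 t).const_mul 27).fun_div
      (((hasDerivAt_pow 3 t).const_add 1).fun_pow 2) (by positivity)
    refine h.congr_deriv ?_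
    norm_num
    field_simp
    ring
  have h := (hasDerivAt_chooseSeries (abs_cubic_parameter_lt h0 h1)).comp t dz
  refine h.congr_deriv ?_
  -- The integral formula divides by t; at t = 0 the factor dz/dt vanishes, as does the claimed
  -- derivative.
  rcases eq_or_ne t 0 with rfl | ht
  · simp
  · rw [integral_sq_div_one_sub (by linarith) h1 ht]
    field_simp

theorem chooseSeries_eq_closedForm {t : ℝ} (h0 : -1 / 2 < t) (h1 : t < 1) :
    chooseSeries (27 * t ^ 3 / (1 + t ^ 3) ^ 2) = chooseSeriesClosedForm t := by
  refine IsOpen.eqOn_of_deriv_eq (s := Set.Ioo (-1 / 2 : ℝ) 1) isOpen_Ioo isPreconnected_Ioo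
    (fun x hx =>
      (hasDerivAt_chooseSeries_comp hx.1 hx.2).differentiableAt.differentiableWithinAt)
    (fun x hx => (hasDerivAt_chooseSeriesClosedForm (by linarith [hx.1]) hx.2
      ).differentiableAt.differentiableWithinAt)
    (fun x hx => by
      rw [(hasDerivAt_chooseSeries_comp hx.1 hx.2).deriv,
        (hasDerivAt_chooseSeriesClosedForm (by linarith [hx.1]) hx.2).deriv])
    (show (0 : ℝ) ∈ Set.Ioo (-1 / 2 : ℝ) 1 by norm_num) ?_ ⟨h0, h1⟩
  simp [chooseSeries, chooseSeriesClosedForm]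

/-! ### The endpoint t = 1 -/

theorem tendsto_closedForm_one :
    Tendsto chooseSeriesClosedForm (𝓝[<] 1) (𝓝 (chooseSeriesClosedForm 1)) := by
  refine ContinuousAt.continuousWithinAt ?_
  unfold chooseSeriesClosedForm
  have h1 : ContinuousAt (fun t : ℝ => √3 * t / (2 - t)) 1 :=
    ContinuousAt.div (by fun_prop) (by fun_prop) (by norm_num)
  have h2 : ContinuousAt (fun t : ℝ => (1 - t + t ^ 2) / (1 + t) ^ 2) 1 :=
    ContinuousAt.div (by fun_prop) (by fun_prop) (by norm_num)
  exact (((continuous_arctan.continuousAt.comp h1).pow 2).const_mul 6).sub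
    (((h2.log (by norm_num)).pow 2).const_mul (1 / 2))

theorem eventually_Ioo_nhdsLT_one : ∀ᶠ t : ℝ in 𝓝[<] 1, t ∈ Set.Ioo (0 : ℝ) 1 :=
  Ioo_mem_nhdsLT zero_lt_one

theorem tendsto_cubic_parameter_one :
    Tendsto (fun t : ℝ => 27 * t ^ 3 / (1 + t ^ 3) ^ 2) (𝓝[<] 1) (𝓝 (27 / 4)) := by
  have : ContinuousAt (fun t : ℝ => 27 * t ^ 3 / (1 + t ^ 3) ^ 2) 1 :=
    ContinuousAt.div (by fun_prop) (by fun_prop) (by norm_num)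
  have h := this.continuousWithinAt (s := Set.Iio 1)
  convert! h.tendsto using 2
  norm_num

/-- The majorant from `invMulChoose_le` is only harmonic here. Instead, each partial sum is a limit,
as t → 1⁻, of partial sums bounded by the closed form at t, hence is at most its value at 1; the
terms are nonnegative. -/
theorem summable_chooseSeries_endpoint :
    Summable fun n : ℕ => (27 / 4 : ℝ) ^ (n + 1) * invMulChoose n / ((n + 1 : ℕ) : ℝ) := by
  have hpos : ∀ (z : ℝ), 0 ≤ z → ∀ n : ℕ,
      0 ≤ z ^ (n + 1) * invMulChoose n / ((n + 1 : ℕ) : ℝ) := fun z hz n => by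
    have := (invMulChoose_pos n).le
    positivity
  refine summable_of_sum_range_le (c := chooseSeriesClosedForm 1) (hpos _ (by norm_num))
    fun N => ?_
  have hcont : Continuous fun z : ℝ =>
      ∑ n ∈ Finset.range N, z ^ (n + 1) * invMulChoose n / ((n + 1 : ℕ) : ℝ) := by fun_prop
  refine le_of_tendsto_of_tendsto ((hcont.tendsto _).comp tendsto_cubic_parameter_one)
    tendsto_closedForm_one ?_
  filter_upwards [eventually_Ioo_nhdsLT_one] with t ht
  have h0 : -1 / 2 < t := by linarith [ht.1]
  rw [← chooseSeries_eq_closedForm h0 ht.2]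
  have : 0 < t := ht.1
  exact (summable_chooseSeries (abs_cubic_parameter_lt h0 ht.2)).sum_le_tsum _
    fun n _ => hpos _ (by positivity) n

/-- Summability at 27/4 is a Weierstrass majorant on the whole closed interval, so S is continuous
up to the endpoint and the identity passes to the limit. -/
theorem chooseSeries_endpoint : chooseSeries (27 / 4) = chooseSeriesClosedForm 1 := by
  have hcont : ContinuousOn chooseSeries (Set.Icc (-(27 / 4)) (27 / 4)) :=
    continuousOn_tsum (fun n => by fun_prop) summable_chooseSeries_endpoint
      fun n z hz => norm_chooseSeries_term_le (abs_le.2 hz) n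
  have h := (hcont (27 / 4) (by norm_num)).tendsto.comp
    (tendsto_nhdsWithin_of_tendsto_nhds_of_eventually_within _ tendsto_cubic_parameter_one
      (by
        filter_upwards [eventually_Ioo_nhdsLT_one] with t ht
        exact abs_le.1 (abs_cubic_parameter_lt (by linarith [ht.1]) ht.2).le))
  refine tendsto_nhds_unique h (tendsto_closedForm_one.congr' ?_)
  filter_upwards [eventually_Ioo_nhdsLT_one] with t ht
  exact (chooseSeries_eq_closedForm (by linarith [ht.1]) ht.2).symm

theorem hasSum_closedForm {t : ℝ} (h0 : -1 / 2 < t) (h1 : t ≤ 1) :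
    HasSum (fun k : ℕ+ => (27 * t ^ 3 / (1 + t ^ 3) ^ 2) ^ (k : ℕ) /
        (((k : ℕ) : ℝ) ^ 2 * (Nat.choose (3 * (k : ℕ)) (k : ℕ) : ℝ)))
      (chooseSeriesClosedForm t) := by
  have key : HasSum (fun n : ℕ => (27 * t ^ 3 / (1 + t ^ 3) ^ 2) ^ (n + 1) * invMulChoose n /
      ((n + 1 : ℕ) : ℝ)) (chooseSeriesClosedForm t) := by
    rcases h1.lt_or_eq with h | rfl
    · rw [← chooseSeries_eq_closedForm h0 h]
      exact (summable_chooseSeries (abs_cubic_parameter_lt h0 h)).hasSum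
    · rw [show (27 * 1 ^ 3 / (1 + 1 ^ 3) ^ 2 : ℝ) = 27 / 4 by norm_num, ← chooseSeries_endpoint]
      exact summable_chooseSeries_endpoint.hasSum
  rw [← Equiv.pnatEquivNat.symm.hasSum_iff]
  refine key.congr_fun fun n => ?_
  simp only [Function.comp, Equiv.pnatEquivNat_symm_apply, Nat.succPNat_coe, Nat.succ_eq_add_one,
    invMulChoose]
  rw [mul_one_div, div_div]
  congr 1
  ring

/-! ### Binet formulas and specialization of t -/

theorem coe_lucasNumber_eq (n : ℕ) :
    (lucasNumber n : ℝ) = goldenRatio ^ n + goldenConj ^ n := by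
  induction n using Nat.twoStepInduction with
  | zero => norm_num [lucasNumber]
  | one => simp [lucasNumber, goldenRatio_add_goldenConj]
  | more n h0 h1 =>
    rw [lucasNumber, Nat.cast_add, h0, h1, pow_add _ n 2, pow_add _ n 2, goldenRatio_sq,
      goldenConj_sq]
    ring

theorem goldenRatio_pow_mul_goldenConj_pow (r : ℕ) :
    goldenRatio ^ r * goldenConj ^ r = (-1) ^ r := by
  rw [← mul_pow, goldenRatio_mul_goldenConj]

/-- For r = 1 this amounts to √5 < 3, and higher powers are smaller. It puts t = ±y/x inside (-1/2,
1/2). -/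
theorem abs_goldenConj_pow_div_lt {r : ℕ} (hr : r ≠ 0) :
    |goldenConj ^ r / goldenRatio ^ r| < 1 / 2 := by
  have h5 : (11 / 5 : ℝ) < √5 := Real.lt_sqrt_of_sq_lt (by norm_num)
  have h5' : √5 < 3 := (Real.sqrt_lt' (by norm_num)).2 (by norm_num)
  have h : |goldenConj / goldenRatio| < 1 / 2 := by
    rw [abs_div, abs_of_pos goldenRatio_pos, abs_of_neg goldenConj_neg,
      div_lt_iff₀ goldenRatio_pos]
    unfold goldenConj goldenRatio
    linarith
  rw [← div_pow, abs_pow]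
  exact (pow_le_of_le_one (abs_nonneg _) (by linarith) hr).trans_lt h

theorem corollary2 (r : ℕ) :
    (r ≠ 0 →
      HasSum
        (fun k : ℕ+ =>
          (-1 : ℝ) ^ ((k : ℤ) * ((r : ℤ) - 1)) * (27 / 5 : ℝ) ^ (k : ℕ) /
            (((k : ℕ) : ℝ) ^ 2 * (Nat.choose (3 * (k : ℕ)) (k : ℕ) : ℝ) *
              (Nat.fib (3 * r) : ℝ) ^ (2 * (k : ℕ))))
        (6 * Real.arctan (Real.sqrt 3 /
              (Real.goldenRatio ^ (2 * r) + Real.goldenRatio ^ r * (lucasNumber r : ℝ))) ^ 2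
          - 1 / 2 * Real.log ((Nat.fib (3 * r) : ℝ) / (5 * (Nat.fib r : ℝ) ^ 3)) ^ 2)) ∧
    HasSum
      (fun k : ℕ+ =>
        (-1 : ℝ) ^ ((k : ℕ) * r) * (27 : ℝ) ^ (k : ℕ) /
          (((k : ℕ) : ℝ) ^ 2 * (Nat.choose (3 * (k : ℕ)) (k : ℕ) : ℝ) *
            (lucasNumber (3 * r) : ℝ) ^ (2 * (k : ℕ))))
      (6 * Real.arctan (Real.sqrt 3 /
            (Real.goldenRatio ^ (2 * r) +
              Real.sqrt 5 * Real.goldenRatio ^ r * (Nat.fib r : ℝ))) ^ 2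
        - 1 / 2 * Real.log ((lucasNumber (3 * r) : ℝ) / (lucasNumber r : ℝ) ^ 3) ^ 2) := by
  have h5 : √5 ^ 2 = 5 := Real.sq_sqrt (by norm_num)
  have h50 : √5 ≠ 0 := by positivity
  have hx : 0 < goldenRatio ^ r := pow_pos goldenRatio_pos r
  have hxy := goldenRatio_pow_mul_goldenConj_pow r
  have hx2 : goldenRatio ^ (2 * r) = (goldenRatio ^ r) ^ 2 := by rw [← pow_mul, mul_comm]
  have hx3 : goldenRatio ^ (3 * r) = (goldenRatio ^ r) ^ 3 := by rw [← pow_mul, mul_comm]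
  have hy3 : goldenConj ^ (3 * r) = (goldenConj ^ r) ^ 3 := by rw [← pow_mul, mul_comm]
  rw [coe_lucasNumber_eq, coe_lucasNumber_eq, coe_fib_eq, coe_fib_eq, hx2, hx3, hy3]
  have habs : r ≠ 0 → |goldenConj ^ r / goldenRatio ^ r| < 1 / 2 := abs_goldenConj_pow_div_lt
  have hle : -1 / 2 < goldenConj ^ r / goldenRatio ^ r ∧
      goldenConj ^ r / goldenRatio ^ r ≤ 1 := by
    -- For r = 0 the ratio is 1, the admissible endpoint of `hasSum_closedForm`.
    rcases eq_or_ne r 0 with rfl | hr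
    · norm_num
    · have := abs_lt.1 (habs hr)
      constructor <;> linarith [this.1, this.2]
  have hsign : ∀ k : ℕ, (-1 : ℝ) ^ ((k : ℤ) * ((r : ℤ) - 1)) = (-(-1) ^ r) ^ k := by
    intro k
    rw [mul_comm, zpow_mul, zpow_natCast, zpow_sub_one₀ (by norm_num), zpow_natCast]
    congr 1
    norm_num
  have hsq : ((-1 : ℝ) ^ r) ^ 2 = 1 := by rw [← pow_mul, mul_comm, pow_mul]; norm_num
  have hcube : ((-1 : ℝ) ^ r) ^ 3 = (-1) ^ r := by rw [pow_succ, hsq, one_mul]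
  -- From here only x > 0, xy = (-1)ʳ and the bounds on y/x matter.
  generalize goldenRatio ^ r = x at *
  generalize goldenConj ^ r = y at *
  constructor
  · intro hr
    have ht := abs_lt.1 (habs hr)
    have hy := (div_lt_iff₀ hx).1 ht.2
    have hd : 0 < x - y := by linarith
    have hs := hasSum_closedForm (t := -(y / x)) (by linarith) (by linarith)
    have hq : 0 < x ^ 2 + x * y + y ^ 2 := by nlinarith [sq_nonneg (x + 2 * y), pow_pos hx 2]
    have hd3 : 0 < x ^ 3 - y ^ 3 := by
      rw [show x ^ 3 - y ^ 3 = (x - y) * (x ^ 2 + x * y + y ^ 2) by ring]; positivity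
    have hden : 0 < 2 * x + y := by
      have := (lt_div_iff₀ hx).1 ht.1
      linarith
    -- Clearing x leaves (xy)³ in the numerator, which is ((-1)ʳ)³ = (-1)ʳ.
    have hz : 27 * (-(y / x)) ^ 3 / (1 + (-(y / x)) ^ 3) ^ 2
        = -(-1) ^ r * (27 / 5) / ((x ^ 3 - y ^ 3) / √5) ^ 2 := by
      rw [← hcube, ← hxy, show 1 + (-(y / x)) ^ 3 = (x ^ 3 - y ^ 3) / x ^ 3 by field_simp; ring,
        div_pow _ √5, h5]
      field_simp
    have hlog : (1 - -(y / x) + (-(y / x)) ^ 2) / (1 + -(y / x)) ^ 2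
        = (x ^ 3 - y ^ 3) / √5 / (5 * ((x - y) / √5) ^ 3) := by
      rw [show 1 + -(y / x) = (x - y) / x by field_simp; ring, div_pow _ √5, pow_succ √5, h5]
      field_simp
      ring
    have harg : √3 * -(y / x) / (2 - -(y / x))
        = -(-1) ^ r * (√3 / (x ^ 2 + x * (x + y))) := by
      rw [← hxy, show 2 - -(y / x) = (2 * x + y) / x by field_simp; ring,
        show x ^ 2 + x * (x + y) = x * (2 * x + y) by ring]
      field_simp
    have hval : chooseSeriesClosedForm (-(y / x)) =
        6 * arctan (√3 / (x ^ 2 + x * (x + y))) ^ 2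
          - 1 / 2 * log ((x ^ 3 - y ^ 3) / √5 / (5 * ((x - y) / √5) ^ 3)) ^ 2 := by
      rw [chooseSeriesClosedForm, hlog, harg]
      -- The arctangent argument matches only up to sign; oddness and squaring remove it.
      rcases neg_one_pow_eq_or ℝ r with h | h <;> simp [h]
    rw [← hval]
    refine hs.congr_fun fun k => ?_
    rw [hsign, hz, div_pow (-(-1) ^ r * (27 / 5)), mul_pow,
      ← pow_mul ((x ^ 3 - y ^ 3) / √5), div_div]
    congr 1
    ring
  · have hd : 0 < x + y := by
      have := (lt_div_iff₀ hx).1 hle.1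
      linarith
    have hs := hasSum_closedForm hle.1 hle.2
    have hq : 0 < x ^ 2 - x * y + y ^ 2 := by nlinarith [sq_nonneg (x - 2 * y), pow_pos hx 2]
    have hd3 : 0 < x ^ 3 + y ^ 3 := by
      rw [show x ^ 3 + y ^ 3 = (x + y) * (x ^ 2 - x * y + y ^ 2) by ring]; positivity
    have hden : 0 < 2 * x - y := by
      have := (div_le_iff₀ hx).1 hle.2
      linarith
    -- Same computation with t = y/x: no √5 enters, since x³ + y³ is the Lucas number itself.
    have hz : 27 * (y / x) ^ 3 / (1 + (y / x) ^ 3) ^ 2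
        = (-1) ^ r * 27 / (x ^ 3 + y ^ 3) ^ 2 := by
      rw [← hcube, ← hxy, show 1 + (y / x) ^ 3 = (x ^ 3 + y ^ 3) / x ^ 3 by field_simp]
      field_simp
    have hlog : (1 - y / x + (y / x) ^ 2) / (1 + y / x) ^ 2
        = (x ^ 3 + y ^ 3) / (x + y) ^ 3 := by
      rw [show 1 + y / x = (x + y) / x by field_simp]
      field_simp
      ring
    have harg : √3 * (y / x) / (2 - y / x)
        = (-1) ^ r * (√3 / (x ^ 2 + √5 * x * ((x - y) / √5))) := by
      rw [← hxy, show 2 - y / x = (2 * x - y) / x by field_simp,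
        show x ^ 2 + √5 * x * ((x - y) / √5) = x * (2 * x - y) by field_simp; ring]
      field_simp
    have hval : chooseSeriesClosedForm (y / x) =
        6 * arctan (√3 / (x ^ 2 + √5 * x * ((x - y) / √5))) ^ 2
          - 1 / 2 * log ((x ^ 3 + y ^ 3) / (x + y) ^ 3) ^ 2 := by
      rw [chooseSeriesClosedForm, hlog, harg]
      rcases neg_one_pow_eq_or ℝ r with h | h <;> simp [h]
    rw [← hval]
    refine hs.congr_fun fun k => ?_
    rw [hz, div_pow, mul_pow, ← pow_mul, ← pow_mul, div_div, mul_comm r]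
    congr 1
    ring
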